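/- **Setting.** Let $G=(V,E)$ be a finite, simple, connected, bipartite graph embedded in the plane, with $V=W\sqcup B$ its white and black vertices and $|W|=|B|$. Let $F^i$ be its set of inner faces. Partition the boundary walk of the outer face into arcs of consecutive edges; this divides the outer face into finitely many *open faces*, one for each arc, forming the set $F^o$. Put $F=F^i\cup F^o$. Each edge $wb$ gives two directed edges $(w,b)$ and $(b,w)$; let $\vec E$ be the set of directed edges, and for $\vec e\in\vec E$ let $f(\vec e)\in F$ be the inner or open face on the right of $\vec e$. A *Kasteleyn orientation* is a function $\varphi:\vec E\to\{-1,1\}$ with $\varphi_{(b,w)}=-\varphi_{(w,b)}$ for every edge $wb$, such that for every inner face $f\in F^i$ of degree $2k$ $$\prod_{wb\in\partial f}\varphi_{(w,b)}=(-1)^{k+1},$$ where boundary edges are counted along the boundary walk of $f$ (an edge with $f$ on both sides counts twice, both in the degree and in the product). A *dimer configuration* is a set of edges such that every vertex is incident to exactly one of them; an *oriented dimer configuration* $\vec{\mathsf M}$ is a dimer configuration together with one orientation for each of its edges. For face weights $a=(a_f)_{f\in F}$ in a commutative ring $R$ (for instance $R=\mathbb C$, or a ring of polynomials in formal variables), let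 $$Z(G,a,\varphi)=\sum_{\vec{\mathsf M}}\ \prod_{\vec e\in\vec{\mathsf M}}\varphi_{\vec e}\,a_{f(\vec e)},$$ the sum being over all oriented dimer configurations. Let $K=(K_{w,b})$ be the matrix with rows indexed by $W$ and columns by $B$, with $K_{w,b}=a_{f(w,b)}-a_{f(b,w)}$ if $wb$ is an edge of $G$ and $K_{w,b}=0$ otherwise; to define $\det K$, fix an ordering of $W$ and an ordering of $B$. **Proposition 3.2.** For every such $G$ and every Kasteleyn orientation $\varphi$ there exists $\epsilon(\varphi)\in\{-1,+1\}$, not depending on the weights, such that for all face weights $a=(a_f)_{f\in F}$ $$Z(G,a,\varphi)=\epsilon(\varphi)\,\det K .$$ -/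

import Mathlib

/-!
Plane graphs are described by their standard combinatorial encoding (rotation systems of genus
zero).  Directed edges of a simple graph `G` are Mathlib's darts `G.Dart`; the two orientations of
an edge are `d` and `d.symm`.
-/

/-- An embedding of a finite connected graph (with at least one edge) in the oriented sphere,
up to orientation-preserving homeomorphism: `rot d` is the directed edge that follows `d` in the
counterclockwise order around the origin of `d`.  The faces are the orbits of
`d ↦ rot d.symm`, and the surface is a sphere by Euler's formula. -/
structure SphereEmbedding {V : Type*} (G : SimpleGraph V) where
  connected : G.Connected
  /-- the counterclockwise rotation around the vertices -/
  rot : Equiv.Perm G.Dart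
  rot_fst : ∀ d : G.Dart, (rot d).fst = d.fst
  /-- around each vertex the rotation is a single cycle -/
  rot_sameCycle : ∀ d d' : G.Dart, d.fst = d'.fst → rot.SameCycle d d'
  /-- Euler's formula `|V| + |faces| = |E| + 2` -/
  euler : Nat.card V +
      Nat.card (Quotient (Equiv.Perm.SameCycle.setoid
        ((Function.Involutive.toPerm (SimpleGraph.Dart.symm (G := G))
          SimpleGraph.Dart.symm_involutive).trans rot))) =
    Nat.card G.edgeSet + 2

namespace SphereEmbedding

variable {V : Type*} {G : SimpleGraph V} (M : SphereEmbedding G)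

/-- The directed edge that follows `d` along the boundary of the face on the right of `d`:
the counterclockwise successor of `d.symm` around the tip of `d`. -/
def next : Equiv.Perm G.Dart :=
  (Function.Involutive.toPerm (SimpleGraph.Dart.symm (G := G))
    SimpleGraph.Dart.symm_involutive).trans M.rot

theorem next_apply (d : G.Dart) : M.next d = M.rot d.symm := rfl

/-- The faces of the embedding (including the one that is declared to be the outer face of a plane
graph). A face is the set of directed edges that have it on their right. -/
def Region : Type _ := Quotient (Equiv.Perm.SameCycle.setoid M.next)

/-- The face of the embedding on the right of a directed edge. -/
def region (d : G.Dart) : M.Region := Quotient.mk _ d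

end SphereEmbedding

/-- A plane graph with open faces.  One face of a spherical embedding is the outer face.
Its boundary walk is partitioned into arcs of consecutive edges by cutting it at some of its
corners: `d ∈ cuts` means that `d` runs along the outer face, and that the boundary walk is
cut at the corner at the origin of `d`, just before `d`. -/
structure OpenFaceGraph {V : Type*} (G : SimpleGraph V) extends SphereEmbedding G where
  outer : toSphereEmbedding.Region
  cuts : Set G.Dart
  cuts_subset : ∀ d ∈ cuts, toSphereEmbedding.region d = outer

namespace OpenFaceGraph

variable {V : Type*} {G : SimpleGraph V} (M : OpenFaceGraph G)

/-- The set `F` of faces, inner and open. Two directed edges that follow each other along a face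
of the embedding have the same face on their right, unless the boundary walk is cut between them.
Hence the inner faces remain whole, and the outer face is divided into the open faces, one for
each arc of its boundary. -/
def Face : Type _ := Quot fun d d' : G.Dart => d' = M.next d ∧ d' ∉ M.cuts

/-- The inner or open face `f(d)` on the right of the directed edge `d`. -/
def rightFace (d : G.Dart) : M.Face := Quot.mk _ d

end OpenFaceGraph

/-- A dimer configuration (perfect matching): a set of edges such that every vertex is incident to
exactly one of them. -/
def IsDimerConfig {V : Type*} (G : SimpleGraph V) (S : Set (Sym2 V)) : Prop :=
  S ⊆ G.edgeSet ∧ ∀ v : V, ∃! e : Sym2 V, e ∈ S ∧ v ∈ e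

/-- An oriented dimer configuration: a dimer configuration with one orientation chosen for each of
its edges. -/
def IsOrientedDimerConfig {V : Type*} {G : SimpleGraph V} (D : Finset G.Dart) : Prop :=
  Set.InjOn SimpleGraph.Dart.edge (D : Set G.Dart) ∧
    IsDimerConfig G (SimpleGraph.Dart.edge '' (D : Set G.Dart))

/-- The orientation from the white to the black end of the edge that underlies `d`.  The white
vertices are those in the left summand. -/
def whiteToBlack {W B : Type*} {G : SimpleGraph (W ⊕ B)} (d : G.Dart) : G.Dart :=
  if d.fst.isLeft then d else d.symm

open Classical in
/-- Kasteleyn orientations: skew-symmetric functions with values in `{-1, 1}`, such that for every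
inner face of degree `2k` the product of `φ (w, b)` over its boundary edges is `(-1) ^ (k + 1)`.
Boundary edges are counted along the boundary walk: an edge with the same face on both sides counts
twice, in the degree and in the product. -/
structure IsKasteleyn {W B : Type*} [Fintype W] [Fintype B] {G : SimpleGraph (W ⊕ B)}
    (M : OpenFaceGraph G) (φ : G.Dart → ℤˣ) : Prop where
  skew : ∀ d : G.Dart, φ d.symm = -φ d
  inner : ∀ f : M.Region, f ≠ M.outer → ∀ k : ℕ,
    (Finset.univ.filter fun d : G.Dart => M.region d = f).card = 2 * k →
      ∏ d ∈ Finset.univ.filter (fun d : G.Dart => M.region d = f), φ (whiteToBlack d) =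
        (-1) ^ (k + 1)

open Classical in
/-- The partition function `Z(G, a, φ)` of oriented dimers. -/
noncomputable def orientedDimerZ {V : Type*} [Fintype V] {G : SimpleGraph V}
    (M : OpenFaceGraph G) {R : Type*} [CommRing R] (a : M.Face → R) (φ : G.Dart → ℤˣ) : R :=
  ∑ D ∈ Finset.univ.filter (fun D : Finset G.Dart => IsOrientedDimerConfig D),
    ∏ d ∈ D, ((φ d : ℤ) : R) * a (M.rightFace d)

open Classical in
/-- The weighted adjacency matrix `K`, with rows indexed by white and columns by black vertices. -/
noncomputable def faceKasteleynMatrix {W B : Type*} {G : SimpleGraph (W ⊕ B)}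
    (M : OpenFaceGraph G) {R : Type*} [CommRing R] (a : M.Face → R) : Matrix W B R :=
  fun w b =>
    if h : G.Adj (Sum.inl w) (Sum.inr b) then
      a (M.rightFace ⟨(Sum.inl w, Sum.inr b), h⟩) -
        a (M.rightFace ⟨(Sum.inr b, Sum.inl w), h.symm⟩)
    else 0

/-! Group oriented dimers by their underlying perfect matching `σ`. By skew-symmetry an edge
contributes `φ (w, b) * K w b`, so `Z` and `det K` are sums of the same products, with signs `t σ =
∏ φ` and `s σ`, a permutation sign. It suffices that `t σ * t τ = s σ * s τ` for any two matchings,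
which is Kasteleyn's theorem (`IsKasteleyn.prod_mul_prod_eq_sign`).

By Euler's formula the symmetric difference of `σ` and `τ` bounds a union `A` of inner faces
(`exists_region_add_region_symm_eq`, `exists_isBoundedBy`). In the product of `φ` over the directed
edges with `A` on their right, edges with `A` on both sides cancel and `t σ * t τ` remains. A face
of degree `2k` is a cycle of `next` of even length, hence of sign `-1`; so the Kasteleyn condition
turns the product into the sign of `next` on `A` times `-1` to the number of directed edges in `A`
that leave white vertices (`prod_union_faces`).

That sign is found without decomposing the boundary into loops or counting enclosed vertices
(`sign_next`). Reversal does not preserve `A`, but let `switch` exchange the two matching edges at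
each vertex: `next` is `rot ∘ switch` after `switch ∘ symm`, and both factors preserve `A`. The
first has one cycle on `A` per vertex that meets `A`, and is even because of the two colours. The
second reverses edges off the matchings and otherwise follows the boundary of `A`; up to counts of
white points its sign is that of `σ τ⁻¹`. -/

namespace Equiv.Perm

/-! ### Signs of permutations from their cycles -/

variable {α β : Type*}

theorem card_subtype_add_card_subtype_not [Fintype α] (p : α → Prop) [DecidablePred p] :
    Fintype.card α = Fintype.card {x // p x} + Fintype.card {x // ¬ p x} := by
  rw [← Fintype.card_sum, Fintype.card_congr (Equiv.sumCompl p)]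

/-- The two orders of restricting a type to two predicates agree. -/
def _root_.Equiv.subtypeSubtypeComm (p q : α → Prop) :
    {x : {x // p x} // q x.1} ≃ {x : {x // q x} // p x.1} where
  toFun x := ⟨⟨x.1.1, x.2⟩, x.1.2⟩
  invFun x := ⟨⟨x.1.1, x.2⟩, x.1.2⟩

theorem card_subtype_eq_add [Fintype α] (c p : α → Prop) [DecidablePred c] [DecidablePred p] :
    Fintype.card {x // c x} =
      Fintype.card {x : {x // p x} // c x.1} + Fintype.card {x : {x // ¬ p x} // c x.1} := by
  rw [card_subtype_add_card_subtype_not (fun x : {x // c x} => p x.1)]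
  congr 1
  · exact Fintype.card_congr (Equiv.subtypeSubtypeComm c p)
  · exact Fintype.card_congr (Equiv.subtypeSubtypeComm c fun x => ¬ p x)

theorem sign_eq_sign_subtypePerm_mul [Fintype α] [DecidableEq α] (f : Perm α) (p : α → Prop)
    [DecidablePred p] (hp : ∀ x, p (f x) ↔ p x) (hn : ∀ x, ¬ p (f x) ↔ ¬ p x) :
    sign f = sign (f.subtypePerm hp) * sign (f.subtypePerm (p := fun x => ¬ p x) hn) := by
  rw [← sign_subtypeCongr]
  congr 1
  ext x
  by_cases h : p x
  · rw [Perm.subtypeCongr.left_apply _ _ h]; rfl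
  · rw [Perm.subtypeCongr.right_apply _ _ h]; rfl

theorem sign_of_forall_sameCycle [Fintype α] [DecidableEq α] [Nonempty α] (f : Perm α)
    (h : ∀ x y, f.SameCycle x y) : sign f = (-1) ^ (Fintype.card α + 1) := by
  rcases subsingleton_or_nontrivial α with hs | hs
  -- A single fixed point counts as a cycle of length one: the exponent is 2.
  · rw [Subsingleton.elim f 1, Fintype.card_eq_one_iff_nonempty_unique.mpr ⟨⟨Classical.arbitrary α⟩, fun _ => Subsingleton.elim _ _⟩]
    simp
  · have hfix : ∀ x, f x ≠ x := by
      intro x hx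
      obtain ⟨y, hy⟩ := exists_ne x
      exact hy (((h x y).eq_of_left hx).symm)
    have hc : f.IsCycle := by
      refine ⟨Classical.arbitrary α, hfix _, fun y _ => h _ y⟩
    have hsupp : f.support = Finset.univ := by
      ext x; simp [hfix]
    rw [hc.sign, hsupp, Finset.card_univ, pow_succ]
    simp

/-- If the fibres of `q` are the cycles of `f`, fixed points included, then the sign of `f` is
determined by the number of points and the number of cycles. -/
theorem sign_eq_neg_one_pow_card_add_card_image [Fintype α] [DecidableEq α] [DecidableEq β]
    (f : Perm α) (q : α → β) (hq : ∀ x, q (f x) = q x)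
    (h : ∀ x y, q x = q y → f.SameCycle x y) :
    sign f = (-1) ^ (Fintype.card α + (Finset.univ.image q).card) := by
  induction hn : (Finset.univ.image q).card generalizing α with
  | zero =>
    have : IsEmpty α := by
      rw [Finset.card_eq_zero, Finset.image_eq_empty, Finset.univ_eq_empty_iff] at hn
      exact hn
    rw [Subsingleton.elim f 1]
    simp
  | succ n ih =>
    have hne : (Finset.univ.image q).Nonempty := by
      rw [← Finset.card_pos]; omega
    obtain ⟨b, hb⟩ := hne
    obtain ⟨x₀, -, hx₀⟩ := Finset.mem_image.mp hb
    have hp : ∀ x, q (f x) = b ↔ q x = b := fun x => by rw [hq]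
    have hpn : ∀ x, ¬ q (f x) = b ↔ ¬ q x = b := fun x => by rw [hq]
    rw [sign_eq_sign_subtypePerm_mul f (fun x => q x = b) hp hpn]
    have : Nonempty {x // q x = b} := ⟨⟨x₀, hx₀⟩⟩
    rw [sign_of_forall_sameCycle (f.subtypePerm hp)
      (fun x y => sameCycle_subtypePerm.mpr (h _ _ (x.2.trans y.2.symm))),
      ih (f.subtypePerm (p := fun x => ¬ q x = b) hpn) (fun x => q x.1) (fun x => hq _)
      (fun x y hxy => sameCycle_subtypePerm.mpr (h _ _ hxy)),
      card_subtype_add_card_subtype_not (fun x => q x = b), ← pow_add]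
    · congr 1; omega
    · have : (Finset.univ.image fun x : {x // ¬ q x = b} => q x.1) = (Finset.univ.image q).erase b := by
        ext c
        simp only [Finset.mem_image, Finset.mem_univ, true_and, Subtype.exists, Finset.mem_erase]
        constructor
        · rintro ⟨a, ha, rfl⟩; exact ⟨ha, a, rfl⟩
        · rintro ⟨hc, a, rfl⟩; exact ⟨a, hc, rfl⟩
      rw [this, Finset.card_erase_of_mem hb, hn]
      rfl

/-! ### Permutations that exchange two colours -/

variable {c : α → Prop} [DecidablePred c]

theorem card_not_eq_card_of_swap_color [Fintype α] (f : Perm α) (h : ∀ x, c (f x) ↔ ¬ c x) :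
    Fintype.card {x // ¬ c x} = Fintype.card {x // c x} :=
  Fintype.card_congr (f.subtypeEquiv fun x => (h x).symm)

theorem card_eq_two_mul_of_swap_color [Fintype α] (f : Perm α) (h : ∀ x, c (f x) ↔ ¬ c x) :
    Fintype.card α = 2 * Fintype.card {x // c x} := by
  rw [card_subtype_add_card_subtype_not c, card_not_eq_card_of_swap_color f h, two_mul]

/-- No point is fixed, so the involution is a product of transpositions, each containing exactly one
point of colour `c`. -/
theorem sign_of_involutive_of_swap_color [Fintype α] [DecidableEq α] (f : Perm α)
    (h : ∀ x, c (f x) ↔ ¬ c x) (hf : ∀ x, f (f x) = x) :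
    sign f = (-1) ^ Fintype.card {x // c x} := by
  have h2 : f ^ 2 = 1 := by ext x; simp [pow_two, hf]
  have hfix : Fintype.card (Function.fixedPoints f) = 0 := by
    rw [Fintype.card_eq_zero_iff]
    refine ⟨fun x => ?_⟩
    have := h x.1
    rw [show f x.1 = x.1 from x.2] at this
    tauto
  rw [sign_of_pow_two_eq_one h2, hfix, card_eq_two_mul_of_swap_color f h]
  congr 1; omega

end Equiv.Perm

/-! ### Faces of the sphere and cycles modulo two -/

namespace SphereEmbedding

variable {V : Type*} {G : SimpleGraph V} (M : SphereEmbedding G)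

theorem region_next (d : G.Dart) : M.region (M.next d) = M.region d :=
  Quotient.sound (s := Equiv.Perm.SameCycle.setoid M.next)
    (Equiv.Perm.SameCycle.symm ⟨1, by simp⟩)

theorem region_rot (d : G.Dart) : M.region (M.rot d) = M.region d.symm := by
  rw [← M.region_next d.symm, next_apply, SimpleGraph.Dart.symm_symm]

theorem region_eq_iff {d d' : G.Dart} : M.region d = M.region d' ↔ M.next.SameCycle d d' :=
  Quotient.eq (r := Equiv.Perm.SameCycle.setoid M.next)

theorem region_surjective : Function.Surjective M.region := Quotient.mk_surjective

instance [Finite V] : Finite G.Dart := by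
  classical
  have := Fintype.ofFinite V
  infer_instance

instance [Finite V] : Finite M.Region := Finite.of_surjective _ M.region_surjective

theorem eq_of_fst_eq_of_rot {α : Type*} (F : G.Dart → α)
    (hF : ∀ d, F (M.rot d) = F d) {d d' : G.Dart} (h : d.fst = d'.fst) : F d = F d' := by
  obtain ⟨i, rfl⟩ := M.rot_sameCycle d d' h
  induction i using Int.induction_on generalizing d with
  | zero => rfl
  | succ i ih =>
    rw [zpow_add_one, Equiv.Perm.mul_apply, ← ih (by rw [M.rot_fst, h, zpow_add_one, Equiv.Perm.mul_apply]), hF]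
  | pred i ih =>
    have h1 : (M.rot⁻¹ d).fst = d.fst := by
      rw [← M.rot_fst]; simp
    rw [zpow_sub_one, Equiv.Perm.mul_apply, ← ih (by rw [h1, h, zpow_sub_one, Equiv.Perm.mul_apply]), ← hF (M.rot⁻¹ d)]
    simp

/-- A function on directed edges that is invariant under reversal and under rotation is
constant. -/
theorem eq_of_symm_of_rot {α : Type*} (F : G.Dart → α) (hs : ∀ d, F d.symm = F d)
    (hr : ∀ d, F (M.rot d) = F d) (d d' : G.Dart) : F d = F d' := by
  obtain ⟨p⟩ := M.connected.preconnected d.fst d'.fst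
  generalize hu : d.fst = u at p
  generalize hv : d'.fst = v at p
  induction p generalizing d with
  | nil => exact M.eq_of_fst_eq_of_rot F hr (hu.trans hv.symm)
  | @cons u w v h p ih =>
    have e : d.fst = (⟨(u, w), h⟩ : G.Dart).fst := hu
    rw [M.eq_of_fst_eq_of_rot F hr e, ← hs]
    exact ih _ rfl hv

theorem _root_.Submodule.finrank_le_one_of_forall_eq {K ι : Type*} [Field K] (S : Submodule K (ι → K))
    (h : ∀ f ∈ S, ∀ i j, f i = f j) : Module.finrank K S ≤ 1 := by
  have hle : S ≤ Submodule.span K {fun _ => (1 : K)} := by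
    intro f hf
    rw [Submodule.mem_span_singleton]
    rcases isEmpty_or_nonempty ι with _ | ⟨⟨i⟩⟩
    · exact ⟨0, Subsingleton.elim _ _⟩
    · exact ⟨f i, funext fun j => by simp [h f hf i j]⟩
  exact (Submodule.finrank_mono hle).trans ((finrank_span_le_card _).trans (by simp))

open Classical in
/-- On the sphere every cycle modulo two is the boundary of a set of faces. -/
theorem exists_region_add_region_symm_eq [Fintype V] (c : G.edgeSet → ZMod 2)
    (hc : ∀ v, ∑ d : G.Dart with d.fst = v, c ⟨d.edge, d.edge_mem⟩ = 0) :
    ∃ g : M.Region → ZMod 2, ∀ d : G.Dart,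
      g (M.region d) + g (M.region d.symm) = c ⟨d.edge, d.edge_mem⟩ := by
  have := Fintype.ofFinite M.Region
  have hD : ∀ e : G.edgeSet, ∃ d : G.Dart, d.edge = e.1 := by
    rintro ⟨e, he⟩
    induction e with
    | h u v => exact ⟨⟨(u, v), he⟩, rfl⟩
  choose D hD using hD
  have hsum : ∀ F : G.Dart → ZMod 2, ∑ d, F d = ∑ e, (F (D e) + F (D e).symm) := by
    intro F
    rw [← Finset.sum_fiberwise Finset.univ (fun d : G.Dart => (⟨d.edge, d.edge_mem⟩ : G.edgeSet))]
    refine Finset.sum_congr rfl fun e _ => ?_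
    have : (Finset.univ.filter fun d : G.Dart => (⟨d.edge, d.edge_mem⟩ : G.edgeSet) = e)
        = {D e, (D e).symm} := by
      ext d
      simp [Subtype.ext_iff, ← hD e, SimpleGraph.dart_edge_eq_iff]
    rw [this, Finset.sum_pair (SimpleGraph.Dart.symm_ne _).symm]
  -- `N` is the incidence matrix, whose kernel is the cycle space; `δ` is the boundary map from sets
  -- of faces to sets of edges.
  let N : Matrix V G.edgeSet (ZMod 2) := fun v e =>
    (if (D e).fst = v then 1 else 0) + (if (D e).snd = v then 1 else 0)
  let δ : (M.Region → ZMod 2) →ₗ[ZMod 2] (G.edgeSet → ZMod 2) :=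
    { toFun := fun g e => g (M.region (D e)) + g (M.region (D e).symm)
      map_add' := fun g g' => by ext e; simp only [Pi.add_apply]; ring
      map_smul' := fun a g => by ext e; simp [mul_add] }
  have hδ : ∀ g d, δ g ⟨d.edge, d.edge_mem⟩ = g (M.region d) + g (M.region d.symm) := by
    intro g d
    have := hD ⟨d.edge, d.edge_mem⟩
    rcases SimpleGraph.dart_edge_eq_iff _ _ |>.mp this with h | h
    · simp [δ, h]
    · simp [δ, h, add_comm]
  have hN : ∀ f v, N.mulVecLin f v = ∑ d : G.Dart with d.fst = v, f ⟨d.edge, d.edge_mem⟩ := by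
    intro f v
    rw [Finset.sum_filter, hsum, Matrix.mulVecLin_apply, Matrix.mulVec, dotProduct]
    refine Finset.sum_congr rfl fun e _ => ?_
    have h1 : (⟨(D e).edge, (D e).edge_mem⟩ : G.edgeSet) = e := Subtype.ext (hD e)
    have h2 : (⟨(D e).symm.edge, (D e).symm.edge_mem⟩ : G.edgeSet) = e :=
      Subtype.ext ((SimpleGraph.Dart.edge_symm _).trans (hD e))
    rw [h1, h2, add_mul, ite_mul, ite_mul]
    simp
  have hrange : LinearMap.range δ ≤ LinearMap.ker N.mulVecLin := by
    rintro _ ⟨g, rfl⟩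
    rw [LinearMap.mem_ker]
    ext v
    -- The left face of `d` is the right face of `rot d`, so around a vertex each face value is
    -- summed twice.
    rw [hN]
    simp only [hδ, Pi.zero_apply, Finset.sum_add_distrib, ← M.region_rot]
    have : ∑ d : G.Dart with d.fst = v, g (M.region (M.rot d)) =
        ∑ d : G.Dart with d.fst = v, g (M.region d) :=
      Finset.sum_equiv M.rot (fun d => by simp [M.rot_fst]) fun _ _ => rfl
    rw [this, CharTwo.add_self_eq_zero]
  -- Both kernels contain only constants, by connectedness: that of `δ` here, that of the transpose
  -- of `N` below.
  have h1 : Module.finrank (ZMod 2) (LinearMap.ker δ) ≤ 1 := by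
    refine Submodule.finrank_le_one_of_forall_eq _ fun g hg i j => ?_
    obtain ⟨d, rfl⟩ := M.region_surjective i
    obtain ⟨d', rfl⟩ := M.region_surjective j
    have hs : ∀ d : G.Dart, g (M.region d.symm) = g (M.region d) := by
      intro d
      have := hδ g d
      rw [LinearMap.mem_ker.mp hg] at this
      exact (CharTwo.add_eq_zero.mp this.symm).symm
    exact M.eq_of_symm_of_rot (fun d => g (M.region d)) hs
      (fun d => by simp only [M.region_rot, hs]) d d'
  have h2 : Module.finrank (ZMod 2) (LinearMap.ker N.transpose.mulVecLin) ≤ 1 := by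
    refine Submodule.finrank_le_one_of_forall_eq _ fun f hf u v => ?_
    have hadj : ∀ u v, G.Adj u v → f u = f v := by
      intro u v h
      have h0 := congrFun (LinearMap.mem_ker.mp hf) ⟨s(u, v), h⟩
      have h3 : f (D ⟨s(u, v), h⟩).fst + f (D ⟨s(u, v), h⟩).snd = 0 := by
        rw [← Pi.zero_apply (M := fun _ : G.edgeSet => ZMod 2) ⟨s(u, v), h⟩, ← h0, Matrix.mulVecLin_apply, Matrix.mulVec, dotProduct]
        have hN' : ∀ e w, N w e =
            (if (D e).fst = w then 1 else 0) + (if (D e).snd = w then 1 else 0) := fun _ _ => rfl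
        simp only [Matrix.transpose_apply, hN', add_mul, ite_mul, one_mul, zero_mul,
          Finset.sum_add_distrib, Finset.sum_ite_eq, Finset.mem_univ, if_true]
      have h4 := hD ⟨s(u, v), h⟩
      rcases SimpleGraph.dart_edge_eq_iff _ (⟨(u, v), h⟩ : G.Dart) |>.mp h4 with h | h
      · rw [h] at h3; exact CharTwo.add_eq_zero.mp h3
      · rw [h] at h3; exact (CharTwo.add_eq_zero.mp h3).symm
    obtain ⟨p⟩ := M.connected.preconnected u v
    induction p with
    | nil => rfl
    | cons h p ih => exact (hadj _ _ h).trans ih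
  have r1 := δ.finrank_range_add_finrank_ker
  have r2 := N.mulVecLin.finrank_range_add_finrank_ker
  have r3 := N.transpose.mulVecLin.finrank_range_add_finrank_ker
  have r4 := N.rank_transpose
  have he := M.euler
  change Nat.card V + Nat.card M.Region = _ at he
  simp only [Matrix.rank, Module.finrank_fintype_fun_eq_card] at r1 r2 r3 r4
  simp only [Nat.card_eq_fintype_card] at he
  -- The cycle space has dimension at most `|E| - |V| + 1`, which is `|faces| - 1` by Euler's
  -- formula, and the rank of `δ` is at least that.
  have heq : LinearMap.range δ = LinearMap.ker N.mulVecLin :=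
    Submodule.eq_of_le_of_finrank_le hrange (by omega)
  have hcm : c ∈ LinearMap.ker N.mulVecLin := by
    rw [LinearMap.mem_ker]
    ext v
    rw [hN, hc, Pi.zero_apply]
  rw [← heq] at hcm
  obtain ⟨g, rfl⟩ := hcm
  exact ⟨g, fun d => (hδ g d).symm⟩

end SphereEmbedding

/-! ### Pairs of perfect matchings and the switch -/

namespace SimpleGraph

variable {V : Type*} {G : SimpleGraph V}

/-- A perfect matching, given by the directed edge `x v` from each vertex `v` to its partner. -/
structure IsDartMatching (x : V → G.Dart) : Prop where
  fst : ∀ v, (x v).fst = v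
  apply_snd : ∀ v, x (x v).snd = (x v).symm

namespace IsDartMatching

variable {x y : V → G.Dart}

theorem snd_snd (hx : IsDartMatching x) (v : V) : (x (x v).snd).snd = v := by
  rw [hx.apply_snd]; exact hx.fst v

theorem symm_eq_iff (hx : IsDartMatching x) (d : G.Dart) :
    d.symm = x d.snd ↔ d = x d.fst := by
  constructor
  · intro h
    have h1 : (x d.snd).snd = d.fst := by rw [← h]; rfl
    rw [← h1, hx.apply_snd, ← h, Dart.symm_symm]
  · intro h
    have h1 : (x d.fst).snd = d.snd := by rw [← h]
    rw [← h1, hx.apply_snd, ← h]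

theorem eq_snd_iff (hx : IsDartMatching x) (hy : IsDartMatching y) (v : V) :
    x (x v).snd = y (x v).snd ↔ x v = y v := by
  have := hy.symm_eq_iff (x v)
  rwa [← hx.apply_snd, hx.fst] at this

open Classical in
/-- At each vertex, exchange the directed edges of the two matchings. -/
noncomputable def switch (x y : V → G.Dart) (d : G.Dart) : G.Dart :=
  if d = x d.fst then y d.fst else if d = y d.fst then x d.fst else d

theorem switch_fst (hx : IsDartMatching x) (hy : IsDartMatching y) (d : G.Dart) :
    (switch x y d).fst = d.fst := by
  unfold switch; split_ifs
  · exact hy.fst _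
  · exact hx.fst _
  · rfl

theorem switch_left (hx : IsDartMatching x) (v : V) : switch x y (x v) = y v := by
  simp [switch, hx.fst]

theorem switch_right (hy : IsDartMatching y) (v : V) : switch x y (y v) = x v := by
  unfold switch; rw [hy.fst]; split_ifs with h h'
  · exact h
  · rfl
  · exact absurd rfl h'

theorem switch_of_ne {d : G.Dart} (h1 : d ≠ x d.fst) (h2 : d ≠ y d.fst) : switch x y d = d := by
  simp [switch, h1, h2]

theorem switch_of_eq {d : G.Dart} (h : x d.fst = y d.fst) : switch x y d = d := by
  unfold switch; split_ifs with h1 h2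
  · rw [← h, ← h1]
  · rw [h, ← h2]
  · rfl

theorem switch_switch (hx : IsDartMatching x) (hy : IsDartMatching y) (d : G.Dart) :
    switch x y (switch x y d) = d := by
  by_cases h1 : d = x d.fst
  · rw [h1, switch_left hx, switch_right hy]
  · by_cases h2 : d = y d.fst
    · rw [h2, switch_right hy, switch_left hx]
    · rw [switch_of_ne h1 h2, switch_of_ne h1 h2]

/-- The permutation of the vertices that follows the first matching from the vertices with the
property `c` and the second one from the others. -/
noncomputable def alternate (hx : IsDartMatching x) (hy : IsDartMatching y) (c : V → Prop)
    [DecidablePred c] (hc : ∀ d : G.Dart, c d.snd ↔ ¬ c d.fst) : Equiv.Perm V where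
  toFun v := if c v then (x v).snd else (y v).snd
  invFun v := if c v then (y v).snd else (x v).snd
  left_inv v := by
    have h1 := hc (x v)
    have h2 := hc (y v)
    rw [hx.fst] at h1
    rw [hy.fst] at h2
    dsimp only
    split_ifs <;> simp_all [hx.snd_snd, hy.snd_snd]
  right_inv v := by
    have h1 := hc (x v)
    have h2 := hc (y v)
    rw [hx.fst] at h1
    rw [hy.fst] at h2
    dsimp only
    split_ifs <;> simp_all [hx.snd_snd, hy.snd_snd]

end IsDartMatching

end SimpleGraph

/-! ### The region between two matchings, seen from a vertex -/

open SimpleGraph IsDartMatching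

/-- The set `A` of directed edges is a union of faces, and its boundary is the symmetric
difference of the matchings `x` and `y`. -/
structure SphereEmbedding.IsBoundedBy {V : Type*} {G : SimpleGraph V} (M : SphereEmbedding G)
    (x y : V → G.Dart) (A : G.Dart → Prop) : Prop where
  left : IsDartMatching x
  right : IsDartMatching y
  rot : ∀ d, A (M.rot d) ↔ A d.symm
  symm : ∀ d, (A d.symm ↔ A d) ↔ ¬ (x d.fst ≠ y d.fst ∧ (d = x d.fst ∨ d = y d.fst))

namespace SphereEmbedding.IsBoundedBy

variable {V : Type*} {G : SimpleGraph V} {M : SphereEmbedding G}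
  {x y : V → G.Dart} {A : G.Dart → Prop}

theorem next (h : M.IsBoundedBy x y A) (d : G.Dart) : A (M.next d) ↔ A d := by
  rw [M.next_apply, h.rot, Dart.symm_symm]

theorem symm_left (h : M.IsBoundedBy x y A) {v : V} (hv : x v ≠ y v) :
    A (x v).symm ↔ ¬ A (x v) := by
  have := h.symm (x v)
  rw [h.left.fst] at this
  tauto

theorem symm_right (h : M.IsBoundedBy x y A) {v : V} (hv : x v ≠ y v) :
    A (y v).symm ↔ ¬ A (y v) := by
  have := h.symm (y v)
  rw [h.right.fst] at this
  tauto

theorem symm_of_ne (h : M.IsBoundedBy x y A) {d : G.Dart} (h1 : d ≠ x d.fst)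
    (h2 : d ≠ y d.fst) : A d.symm ↔ A d := by
  rw [h.symm]; tauto

theorem symm_of_eq (h : M.IsBoundedBy x y A) {d : G.Dart} (h1 : x d.fst = y d.fst) :
    A d.symm ↔ A d := by
  rw [h.symm]; tauto

open Classical in
/-- The directed edge of `x` or `y` at `v` that has `A` on its right, if there is one. -/
noncomputable def pick (x y : V → G.Dart) (A : G.Dart → Prop) (v : V) : G.Dart :=
  if A (x v) then x v else y v

theorem pick_fst (h : M.IsBoundedBy x y A) (v : V) : (pick x y A v).fst = v := by
  unfold pick; split_ifs
  · exact h.left.fst v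
  · exact h.right.fst v

theorem color_pick_snd (h : M.IsBoundedBy x y A) {c : V → Prop}
    (hc : ∀ d : G.Dart, c d.snd ↔ ¬ c d.fst) (v : V) : c (pick x y A v).snd ↔ ¬ c v := by
  rw [hc, h.pick_fst]

variable [Finite V]

theorem exists_rot_pow_eq (M : SphereEmbedding G) {d d' : G.Dart} (h : d.fst = d'.fst) :
    ∃ j : ℕ, (M.rot ^ j) d = d' :=
  (M.rot_sameCycle d d' h).exists_nat_pow_eq

/-- Where the matchings differ, exactly one of their directed edges has `A` on its right. -/
theorem right_iff (h : M.IsBoundedBy x y A) {v : V} (hv : x v ≠ y v) :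
    A (y v) ↔ ¬ A (x v) := by
  -- Turning around `v`, membership in `A` changes only on passing an edge of `x` or `y`. It changes
  -- at `x v`, so it must change back at `y v` before the turn is complete.
  have key : ∀ (j : ℕ) (d : G.Dart), d.fst = v → (A d ↔ ¬ A (x v)) → (M.rot ^ j) d = x v →
      (A (y v) ↔ ¬ A (x v)) := by
    intro j
    induction j with
    | zero =>
      intro d _ hA hd
      rw [pow_zero, Equiv.Perm.one_apply] at hd
      rw [hd] at hA; tauto
    | succ j ih =>
      intro d hd hA hj
      by_cases hy : d = y v
      · rwa [hy] at hA
      have hx : d ≠ x v := by rintro rfl; tauto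
      refine ih (M.rot d) ((M.rot_fst d).trans hd) ?_ (by rwa [pow_succ] at hj)
      rw [h.rot, h.symm_of_ne (by rwa [hd]) (by rwa [hd]), hA]
  have hf : (M.rot (x v)).fst = (x v).fst := M.rot_fst _
  obtain ⟨j, hj⟩ := exists_rot_pow_eq M hf
  refine key j _ (hf.trans (h.left.fst v)) ?_ hj
  rw [h.rot, h.symm_left hv]

/-- Where the matchings differ, `rot` after `x v` crosses the boundary of `A`, and so does
exchanging `x v` with `y v`: the two changes cancel. -/
theorem rot_switch (h : M.IsBoundedBy x y A) (d : G.Dart) :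
    A (M.rot (switch x y d)) ↔ A d := by
  rw [h.rot]
  by_cases hv : x d.fst = y d.fst
  · rw [switch_of_eq hv, h.symm_of_eq hv]
  · by_cases h1 : d = x d.fst
    · generalize d.fst = v at *
      subst h1
      rw [switch_left h.left, h.symm_right hv, h.right_iff hv, not_not]
    · by_cases h2 : d = y d.fst
      · generalize d.fst = v at *
        subst h2
        rw [switch_right h.right, h.symm_left hv, h.right_iff hv]
      · rw [switch_of_ne h1 h2, h.symm_of_ne h1 h2]

theorem switch_symm (h : M.IsBoundedBy x y A) (d : G.Dart) :
    A (switch x y d.symm) ↔ A d := by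
  rw [← h.rot_switch, switch_switch h.left h.right, h.rot, Dart.symm_symm]

theorem eq_pick (h : M.IsBoundedBy x y A) {d : G.Dart} (hd : A d)
    (hxy : d = x d.fst ∨ d = y d.fst) : d = pick x y A d.fst := by
  unfold pick
  generalize d.fst = v at *
  split_ifs with hA
  · rcases hxy with rfl | rfl
    · rfl
    · by_contra hne
      exact (h.right_iff (Ne.symm hne)).mp hd hA
  · rcases hxy with rfl | rfl
    · exact absurd hd hA
    · rfl

/-- The permutation `d ↦ rot (switch d)` permutes the elements of `A` at a given vertex
cyclically. -/
theorem sameCycle_pick (h : M.IsBoundedBy x y A) {f : Equiv.Perm G.Dart}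
    (hf : ∀ d, f d = M.rot (switch x y d)) {d : G.Dart} (hd : A d) :
    A (pick x y A d.fst) ∧ f.SameCycle d (pick x y A d.fst) := by
  -- Rotation from `d` stays in `A` until it meets an edge of `x` or `y`, which is then the picked
  -- one; up to there `switch` does nothing.
  have key : ∀ (j : ℕ) (d : G.Dart), A d → (M.rot ^ j) d = pick x y A d.fst →
      A (pick x y A d.fst) ∧ f.SameCycle d (pick x y A d.fst) := by
    intro j
    induction j with
    | zero =>
      intro d hA hd
      rw [pow_zero, Equiv.Perm.one_apply] at hd
      rw [← hd]
      exact ⟨hA, .rfl⟩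
    | succ j ih =>
      intro d hd hj
      by_cases hp : d = pick x y A d.fst
      · rw [← hp]
        exact ⟨hd, .rfl⟩
      have hnx : ¬ (d = x d.fst ∨ d = y d.fst) := fun h' => hp (h.eq_pick hd h')
      rw [not_or] at hnx
      have hfd : f d = M.rot d := by rw [hf, switch_of_ne hnx.1 hnx.2]
      have hfst : (f d).fst = d.fst := by rw [hfd, M.rot_fst]
      have := ih (f d) (by rw [hf, h.rot_switch]; exact hd)
        (by rw [hfst, ← hj, hfd, pow_succ, Equiv.Perm.mul_apply])
      rw [hfst] at this
      exact this.imp_right Equiv.Perm.sameCycle_apply_left.mp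
  obtain ⟨j, hj⟩ := exists_rot_pow_eq M (h.pick_fst d.fst).symm
  exact key j d hd hj

end SphereEmbedding.IsBoundedBy

/-! ### Signs of the two factors of the face permutation -/

namespace SphereEmbedding.IsBoundedBy

variable {V : Type*} {G : SimpleGraph V} {M : SphereEmbedding G}
  {x y : V → G.Dart} {A : G.Dart → Prop}

/-- The boundary of `A` is traversed with `A` on the right: at the tip of a picked edge the next one
belongs to the other matching. A common edge is simply reversed. -/
theorem pick_snd [Finite V] (h : M.IsBoundedBy x y A) (v : V) :
    pick x y A (pick x y A v).snd = switch x y (pick x y A v).symm := by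
  by_cases hv : x v = y v
  · have h1 : ∀ u, x u = y u → pick x y A u = y u := fun u hu => by
      unfold pick; rw [hu, ite_self]
    rw [h1 v hv, ← hv, ← h.left.apply_snd, switch_left h.left]
    exact h1 _ ((h.left.eq_snd_iff h.right v).mpr hv)
  · by_cases hA : A (x v)
    · have hp : pick x y A v = x v := if_pos hA
      rw [hp, ← h.left.apply_snd, switch_left h.left]
      refine if_neg ?_
      rw [h.left.apply_snd, h.symm_left hv]
      exact not_not.mpr hA
    · have hp : pick x y A v = y v := if_neg hA
      have hu : x (y v).snd ≠ y (y v).snd := fun e =>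
        hv ((h.right.eq_snd_iff h.left v).mp e.symm).symm
      rw [hp, ← h.right.apply_snd, switch_right h.right]
      refine if_pos ?_
      by_contra hA'
      rw [← h.right_iff hu, h.right.apply_snd, h.symm_right hv, h.right_iff hv] at hA'
      exact hA' hA

variable {c : V → Prop} [DecidablePred c]

/-- Following `pick` is a permutation of the vertices. Each of its cycles is a cycle of the
alternating permutation or of its inverse. -/
theorem exists_perm_pick [Fintype V] [DecidableEq V] (h : M.IsBoundedBy x y A)
    (hc : ∀ d : G.Dart, c d.snd ↔ ¬ c d.fst) :
    ∃ T : Equiv.Perm V, (∀ v, T v = (pick x y A v).snd) ∧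
      Equiv.Perm.sign T = Equiv.Perm.sign (h.left.alternate h.right c hc) := by
  classical
  set f := h.left.alternate h.right c hc with hf
  have hf1 : ∀ v, f v = if c v then (x v).snd else (y v).snd := fun _ => rfl
  have hf2 : ∀ v, f⁻¹ v = if c v then (y v).snd else (x v).snd := fun _ => rfl
  -- `P` holds on the alternating cycles that `alternate` traverses with `A` on the right. There
  -- `pick` follows `alternate`, and elsewhere its inverse, which has the same sign. On common edges
  -- the two agree.
  let P : V → Prop := fun v => x v ≠ y v ∧ (c v ↔ A (x v))
  have hcx : ∀ v, c (x v).snd ↔ ¬ c v := fun v => by rw [hc, h.left.fst]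
  have hcy : ∀ v, c (y v).snd ↔ ¬ c v := fun v => by rw [hc, h.right.fst]
  have hP : ∀ v, P (f v) ↔ P v := by
    intro v
    rw [hf1]
    split_ifs with hv
    · have hPv : P (x v).snd ↔ x v ≠ y v ∧ (c (x v).snd ↔ A (x (x v).snd)) :=
        and_congr (not_congr (h.left.eq_snd_iff h.right v)) Iff.rfl
      rw [hPv]
      refine and_congr_right fun hne => ?_
      rw [hcx, h.left.apply_snd, h.symm_left hne]
      tauto
    · have hne' : x (y v).snd = y (y v).snd ↔ x v = y v := by
        rw [eq_comm, h.right.eq_snd_iff h.left, eq_comm]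
      have hPv : P (y v).snd ↔ x v ≠ y v ∧ (c (y v).snd ↔ A (x (y v).snd)) :=
        and_congr (not_congr hne') Iff.rfl
      rw [hPv]
      refine and_congr_right fun hne => ?_
      have h1 := h.right_iff (hne'.not.mpr hne)
      rw [h.right.apply_snd, h.symm_right hne, h.right_iff hne] at h1
      rw [hcy]
      tauto
  have hP' : ∀ v, ¬ P (f⁻¹ v) ↔ ¬ P v := fun v => by
    rw [← hP (f⁻¹ v), show f (f⁻¹ v) = v from f.apply_symm_apply v]
  refine ⟨(f.subtypePerm hP).subtypeCongr (f⁻¹.subtypePerm (p := fun v => ¬ P v) hP'), fun v => ?_, ?_⟩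
  · by_cases hv : P v
    · rw [Equiv.Perm.subtypeCongr.left_apply _ _ hv]
      change f v = _
      rw [hf1]
      obtain ⟨-, hv⟩ := hv
      unfold pick
      split_ifs <;> simp_all
    · rw [Equiv.Perm.subtypeCongr.right_apply _ _ hv]
      change f⁻¹ v = _
      rw [hf2]
      by_cases hxy : x v = y v
      · unfold pick; rw [hxy, ite_self, ite_self]
      · unfold pick
        have hv : ¬ (c v ↔ A (x v)) := fun h => hv ⟨hxy, h⟩
        split_ifs <;> simp_all
  · have hn : ∀ v, ¬ P (f v) ↔ ¬ P v := fun v => not_congr (hP v)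
    rw [Equiv.Perm.sign_subtypeCongr, Equiv.Perm.sign_eq_sign_subtypePerm_mul f P hP hn]
    congr 1
    rw [← Equiv.Perm.sign_inv]
    rfl

/-- The directed edges of `A` at one vertex form a single cycle through the picked one, so the
cycles correspond to the vertices whose picked edge lies in `A`. -/
theorem sign_rot_switch [Fintype V] [DecidableEq G.Dart] [Fintype G.Dart] [DecidablePred A]
    (h : M.IsBoundedBy x y A) {f : Equiv.Perm G.Dart} (hf : ∀ d, f d = M.rot (switch x y d))
    (hA : ∀ d, A (f d) ↔ A d) :
    Equiv.Perm.sign (f.subtypePerm hA) =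
      (-1) ^ (Fintype.card {d // A d} + Fintype.card {v // A (pick x y A v)}) := by
  classical
  have hfst : ∀ d, (f d).fst = d.fst := fun d => by
    rw [hf, M.rot_fst, switch_fst h.left h.right]
  rw [Equiv.Perm.sign_eq_neg_one_pow_card_add_card_image (f.subtypePerm hA) (fun d => d.1.fst)
    (fun d => hfst d.1)]
  · congr 2
    rw [Fintype.card_subtype]
    congr 1
    ext v
    simp only [Finset.mem_image, Finset.mem_univ, true_and, Finset.mem_filter, Subtype.exists]
    constructor
    · rintro ⟨d, hd, rfl⟩
      exact (h.sameCycle_pick hf hd).1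
    · exact fun hv => ⟨_, hv, h.pick_fst v⟩
  · rintro ⟨d, hd⟩ ⟨d', hd'⟩ (hdd : d.fst = d'.fst)
    rw [Equiv.Perm.sameCycle_subtypePerm]
    refine (h.sameCycle_pick hf hd).2.trans ?_
    rw [hdd]
    exact (h.sameCycle_pick hf hd').2.symm

/-- On the picked edges in `A` the map is conjugate to `T`; on the rest of `A` it is edge reversal,
whose sign cancels the white edges there. `T` also moves vertices without edges in `A`, where it
swaps the ends of common edges; these account for the remaining white vertices. -/
theorem sign_switch_symm [Fintype V] [DecidableEq V] [DecidableEq G.Dart] [Fintype G.Dart]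
    [DecidablePred A] (h : M.IsBoundedBy x y A) (hc : ∀ d : G.Dart, c d.snd ↔ ¬ c d.fst)
    {f : Equiv.Perm G.Dart} (hf : ∀ d, f d = switch x y d.symm) (hA : ∀ d, A (f d) ↔ A d) :
    Equiv.Perm.sign (f.subtypePerm hA) * (-1) ^ Fintype.card {d : {d // A d} // c d.1.fst} =
      Equiv.Perm.sign (h.left.alternate h.right c hc) * (-1) ^ Fintype.card {v // c v} := by
  obtain ⟨T, hT, hsign⟩ := h.exists_perm_pick hc
  rw [← hsign]
  have hpT : ∀ v, pick x y A (T v) = f (pick x y A v) := fun v => by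
    rw [hT, hf, h.pick_snd]
  let p : {d // A d} → Prop := fun d => d.1 = pick x y A d.1.fst
  have hout : ∀ d : {d // A d}, ¬ p d →
      (d.1 ≠ x d.1.fst ∧ d.1 ≠ y d.1.fst) ∧ f d.1 = d.1.symm ∧
        d.1.symm ≠ pick x y A d.1.snd := by
    rintro ⟨d, hd⟩ hp
    have h0 : ¬ (d = x d.fst ∨ d = y d.fst) := fun h' => hp (h.eq_pick hd h')
    rw [not_or] at h0
    have h1 : d.symm ≠ x d.snd := (h.left.symm_eq_iff d).not.mpr h0.1
    have h2 : d.symm ≠ y d.snd := (h.right.symm_eq_iff d).not.mpr h0.2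
    refine ⟨h0, (hf d).trans (switch_of_ne h1 h2), ?_⟩
    unfold pick
    split_ifs
    · exact h1
    · exact h2
  have hp : ∀ d, p (f.subtypePerm hA d) ↔ p d := by
    rintro ⟨d, hd⟩
    constructor
    · intro h1
      by_contra h2
      obtain ⟨-, h3, h4⟩ := hout ⟨d, hd⟩ h2
      change f d = pick x y A (f d).fst at h1
      rw [h3] at h1
      exact h4 h1
    · intro h1
      change d = pick x y A d.fst at h1
      change f d = pick x y A (f d).fst
      rw [h1, ← hpT, h.pick_fst]
  have hn : ∀ d, ¬ p (f.subtypePerm hA d) ↔ ¬ p d := fun d => not_congr (hp d)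
  let q : V → Prop := fun v => A (pick x y A v)
  have hq : ∀ v, q (T v) ↔ q v := fun v => by
    change A (pick x y A (T v)) ↔ _
    rw [hpT, hA]
  have hqn : ∀ v, ¬ q (T v) ↔ ¬ q v := fun v => not_congr (hq v)
  have hcT : ∀ v, c (T v) ↔ ¬ c v := fun v => by rw [hT, h.color_pick_snd hc]
  let e : {d : {d // A d} // p d} ≃ {v // q v} :=
    { toFun := fun d => ⟨d.1.1.fst, by
        have := d.1.2
        have h1 : d.1.1 = pick x y A d.1.1.fst := d.2
        rwa [h1] at this⟩
      invFun := fun v => ⟨⟨pick x y A v.1, v.2⟩, by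
        change pick x y A v.1 = pick x y A (pick x y A v.1).fst
        rw [h.pick_fst]⟩
      left_inv := fun d => Subtype.ext (Subtype.ext d.2.symm)
      right_inv := fun v => Subtype.ext (h.pick_fst v.1) }
  have he : Equiv.Perm.sign ((f.subtypePerm hA).subtypePerm hp) =
      Equiv.Perm.sign (T.subtypePerm hq) := by
    refine Equiv.Perm.sign_eq_sign_of_equiv _ _ e fun d => Subtype.ext ?_
    change (f d.1.1).fst = T d.1.1.fst
    have h1 : d.1.1 = pick x y A d.1.1.fst := d.2
    rw [h1, ← hpT, h.pick_fst, h.pick_fst]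
  have hecard : Fintype.card {d : {d : {d // A d} // p d} // c d.1.1.fst} =
      Fintype.card {v : {v // q v} // c v.1} :=
    Fintype.card_congr (e.subtypeEquiv fun d => Iff.rfl)
  have hs1 : Equiv.Perm.sign ((f.subtypePerm hA).subtypePerm (p := fun d => ¬ p d) hn) =
      (-1) ^ Fintype.card {d : {d : {d // A d} // ¬ p d} // c d.1.1.fst} := by
    refine Equiv.Perm.sign_of_involutive_of_swap_color (c := fun d : {d : {d // A d} // ¬ p d} => c d.1.1.fst) _ ?_ ?_
    · rintro ⟨d, hd⟩
      change c (f d.1).fst ↔ ¬ c d.1.fst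
      rw [(hout d hd).2.1]
      exact hc d.1
    · rintro ⟨d, hd⟩
      refine Subtype.ext (Subtype.ext ?_)
      change f (f d.1) = d.1
      obtain ⟨h0, h1, -⟩ := hout d hd
      rw [h1, hf, Dart.symm_symm, switch_of_ne h0.1 h0.2]
  have hs2 : Equiv.Perm.sign (T.subtypePerm (p := fun v => ¬ q v) hqn) =
      (-1) ^ Fintype.card {v : {v // ¬ q v} // c v.1} := by
    refine Equiv.Perm.sign_of_involutive_of_swap_color (c := fun v : {v // ¬ q v} => c v.1) _ ?_ ?_
    · exact fun v => hcT v.1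
    · rintro ⟨v, hv⟩
      refine Subtype.ext ?_
      change T (T v) = v
      -- If the matchings differed at `v`, one of their two edges would lie in `A` and be picked.
      have hxy : x v = y v := by
        by_contra hne
        have := h.right_iff hne
        change ¬ A (pick x y A v) at hv
        unfold pick at hv
        split_ifs at hv <;> tauto
      have hyx : x (x v).snd = y (x v).snd := (h.left.eq_snd_iff h.right v).mpr hxy
      rw [hT, hT]
      have h1 : ∀ u, x u = y u → pick x y A u = x u := fun u hu => by
        unfold pick; rw [hu, ite_self]
      rw [h1 v hxy, h1 _ hyx, h.left.snd_snd]
  rw [Equiv.Perm.sign_eq_sign_subtypePerm_mul _ p hp hn,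
    Equiv.Perm.sign_eq_sign_subtypePerm_mul T q hq hqn, he, hs1, hs2,
    Equiv.Perm.card_subtype_eq_add (fun d : {d // A d} => c d.1.fst) p,
    Equiv.Perm.card_subtype_eq_add c q, hecard, pow_add, pow_add]
  have hsq : ∀ (s u : ℤˣ) (k : ℕ), s * (-1) ^ k * (u * (-1) ^ k) = s * u := fun s u k => by
    rw [mul_mul_mul_comm, ← pow_add, ← two_mul, pow_mul, neg_one_sq, one_pow, mul_one]
  rw [hsq, hsq]

/-- The sign of the face permutation on the union `A` of faces. -/
theorem sign_next [Fintype V] [DecidableEq V] [DecidableEq G.Dart] [Fintype G.Dart]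
    [DecidablePred A] (h : M.IsBoundedBy x y A) (hc : ∀ d : G.Dart, c d.snd ↔ ¬ c d.fst) :
    Equiv.Perm.sign (M.next.subtypePerm h.next) *
        (-1) ^ Fintype.card {d : {d // A d} // c d.1.fst} =
      Equiv.Perm.sign (h.left.alternate h.right c hc) * (-1) ^ Fintype.card {v // c v} := by
  let s : Equiv.Perm G.Dart := Function.Involutive.toPerm _ (switch_switch h.left h.right)
  let ι : Equiv.Perm G.Dart := Function.Involutive.toPerm _ (Dart.symm_involutive (G := G))
  have h1 := h.sign_rot_switch (f := M.rot * s) (fun _ => rfl) h.rot_switch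
  have h2 := h.sign_switch_symm hc (f := s * ι) (fun _ => rfl) h.switch_symm
  obtain ⟨T, hT, -⟩ := h.exists_perm_pick hc
  have hq : ∀ v, A (pick x y A (T v)) ↔ A (pick x y A v) := fun v => by
    rw [hT, h.pick_snd, h.switch_symm]
  have hA := Equiv.Perm.card_eq_two_mul_of_swap_color
    (c := fun d : {d // A d} => c d.1.fst) (M.next.subtypePerm h.next) fun d => by
      change c (M.rot _).fst ↔ _
      rw [M.rot_fst]
      exact hc d.1
  have hV := Equiv.Perm.card_eq_two_mul_of_swap_color
    (c := fun v : {v // A (pick x y A v)} => c v.1) (T.subtypePerm hq) fun v => by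
      change c (T v.1) ↔ _
      rw [hT, h.color_pick_snd hc]
  -- Both counts in the exponent are even, because `next` and `T` exchange the colours; so this
  -- factor has sign 1.
  rw [hA, hV, ← mul_add, pow_mul, neg_one_sq, one_pow] at h1
  have hprod : M.next.subtypePerm h.next = (M.rot * s).subtypePerm h.rot_switch *
      (s * ι).subtypePerm h.switch_symm := by
    refine Equiv.ext fun d => Subtype.ext ?_
    change M.rot d.1.symm = M.rot (switch x y (switch x y d.1.symm))
    rw [switch_switch h.left h.right]
  rw [← h2, hprod, Equiv.Perm.sign_mul, h1, one_mul]

end SphereEmbedding.IsBoundedBy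

open Classical in
/-- The symmetric difference of two perfect matchings bounds a union of faces that does not
contain a given face. -/
theorem SphereEmbedding.exists_isBoundedBy {V : Type*} [Finite V] {G : SimpleGraph V}
    (M : SphereEmbedding G) {x y : V → G.Dart} (hx : IsDartMatching x) (hy : IsDartMatching y)
    (o : M.Region) :
    ∃ s : M.Region → Prop, ¬ s o ∧ M.IsBoundedBy x y fun d => s (M.region d) := by
  have := Fintype.ofFinite V
  have hmem : ∀ {z : V → G.Dart}, IsDartMatching z → ∀ d : G.Dart,
      (∃ v, (z v).edge = d.edge) ↔ d = z d.fst := by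
    intro z hz d
    constructor
    · rintro ⟨v, hv⟩
      rcases (dart_edge_eq_iff _ _).mp hv with h | h
      · have : v = d.fst := by rw [← hz.fst v, h]
        rw [← this, h]
      · rw [← hz.symm_eq_iff, ← h]
        have : v = d.snd := by rw [← hz.fst v, h]; rfl
        rw [this]
    · intro h
      exact ⟨d.fst, by rw [← h]⟩
  have hcount : ∀ {z : V → G.Dart}, IsDartMatching z → ∀ v,
      ∑ d : G.Dart with d.fst = v, (if d = z d.fst then (1 : ZMod 2) else 0) = 1 := by
    intro z hz v
    rw [Finset.sum_eq_single (z v)]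
    · rw [if_pos (by rw [hz.fst])]
    · intro d hd hne
      rw [(Finset.mem_filter.mp hd).2, if_neg hne]
    · intro h
      exact absurd (by simp [hz.fst]) h
  obtain ⟨g, hg⟩ := M.exists_region_add_region_symm_eq
    (fun e => (if ∃ v, (x v).edge = e.1 then 1 else 0) + (if ∃ v, (y v).edge = e.1 then 1 else 0))
    (by
      intro v
      simp only [hmem hx, hmem hy, Finset.sum_add_distrib, hcount hx, hcount hy]
      rfl)
  simp only [hmem hx, hmem hy] at hg
  -- `g` and its complement have the same boundary; the one that vanishes on `o` is taken.
  refine ⟨fun f => g f ≠ g o, fun h => h rfl, hx, hy, fun d => by rw [M.region_rot], fun d => ?_⟩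
  have h2 : ∀ a b c : ZMod 2, (b ≠ c ↔ a ≠ c) ↔ a + b = 0 := by decide
  rw [h2, hg]
  by_cases h3 : d = x d.fst <;> by_cases h4 : d = y d.fst
  · have h5 : x d.fst = y d.fst := h3.symm.trans h4
    rw [if_pos h3, if_pos h4]
    simp only [h5, ne_eq, not_true_eq_false, false_and, not_false_eq_true, iff_true]
    rfl
  · rw [if_pos h3, if_neg h4]
    have : x d.fst ≠ y d.fst := fun h => h4 (h3.trans h)
    simp only [add_zero, one_ne_zero, false_iff, not_not]
    exact ⟨this, Or.inl h3⟩
  · rw [if_neg h3, if_pos h4]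
    have : x d.fst ≠ y d.fst := fun h => h3 (h4.trans h.symm)
    simp only [zero_add, one_ne_zero, false_iff, not_not]
    exact ⟨this, Or.inr h4⟩
  · rw [if_neg h3, if_neg h4]
    simp [h3, h4]

/-! ### Kasteleyn's theorem for two matchings -/

section Bipartite

variable {W B : Type*} {G : SimpleGraph (W ⊕ B)}

theorem isLeft_snd_iff (hG : G.IsBipartiteWith (Set.range Sum.inl) (Set.range Sum.inr))
    (d : G.Dart) : d.snd.isLeft ↔ ¬ d.fst.isLeft := by
  rcases hG.mem_of_adj d.adj with ⟨⟨w, h1⟩, ⟨b, h2⟩⟩ | ⟨⟨w, h1⟩, ⟨b, h2⟩⟩ <;>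
    rw [← h1, ← h2] <;> simp

theorem whiteToBlack_of_isLeft {d : G.Dart} (h : d.fst.isLeft) : whiteToBlack d = d := if_pos h

theorem whiteToBlack_symm (hG : G.IsBipartiteWith (Set.range Sum.inl) (Set.range Sum.inr))
    {d : G.Dart} (h : d.fst.isLeft) : whiteToBlack d.symm = d := by
  have : ¬ d.symm.fst.isLeft := fun h' => (isLeft_snd_iff hG d).mp h' h
  rw [whiteToBlack, if_neg this, Dart.symm_symm]

/-- The directed edges of a perfect matching of a bipartite graph. -/
def matchingDart (σ : W ≃ B) (hσ : ∀ w, G.Adj (Sum.inl w) (Sum.inr (σ w))) : W ⊕ B → G.Dart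
  | Sum.inl w => ⟨(Sum.inl w, Sum.inr (σ w)), hσ w⟩
  | Sum.inr b => ⟨(Sum.inr b, Sum.inl (σ.symm b)), by
      have := hσ (σ.symm b)
      rw [σ.apply_symm_apply] at this
      exact this.symm⟩

theorem isDartMatching_matchingDart (σ : W ≃ B) (hσ : ∀ w, G.Adj (Sum.inl w) (Sum.inr (σ w))) :
    IsDartMatching (matchingDart σ hσ) where
  fst v := by cases v <;> rfl
  apply_snd v := by
    cases v with
    | inl w => exact Dart.ext _ _ (by simp [matchingDart, Dart.symm])
    | inr b => exact Dart.ext _ _ (by simp [matchingDart, Dart.symm])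

variable [Fintype W] [Fintype B]

theorem sign_alternate_matchingDart [DecidableEq W] [DecidableEq B]
    (hG : G.IsBipartiteWith (Set.range Sum.inl) (Set.range Sum.inr))
    (σ τ : W ≃ B) (hσ : ∀ w, G.Adj (Sum.inl w) (Sum.inr (σ w)))
    (hτ : ∀ w, G.Adj (Sum.inl w) (Sum.inr (τ w))) :
    Equiv.Perm.sign ((isDartMatching_matchingDart σ hσ).alternate
        (isDartMatching_matchingDart τ hτ) (fun v => v.isLeft) (isLeft_snd_iff hG)) *
      (-1) ^ Fintype.card {v : W ⊕ B // v.isLeft} = Equiv.Perm.sign (σ.trans τ.symm) := by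
  -- `J` swaps the ends of each edge of `τ`. Composed with the alternating permutation it gives `τ⁻¹
  -- σ` on `W` and the identity on `B`.
  let J : Equiv.Perm (W ⊕ B) := (Equiv.sumCongr τ τ.symm).trans (Equiv.sumComm B W)
  have hJ : Equiv.Perm.sign J = (-1) ^ Fintype.card {v : W ⊕ B // v.isLeft} :=
    Equiv.Perm.sign_of_involutive_of_swap_color (c := fun v : W ⊕ B => v.isLeft) J
      (by rintro (w | b) <;> simp [J]) (by rintro (w | b) <;> simp [J])
  rw [← hJ, mul_comm, ← Equiv.Perm.sign_mul, ← mul_one (Equiv.Perm.sign (σ.trans τ.symm)),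
    ← Equiv.Perm.sign_one (α := B), ← Equiv.Perm.sign_sumCongr]
  congr 1
  ext v
  rcases v with w | b
  · simp [J, alternate, matchingDart]
  · simp [J, alternate, matchingDart]

open Classical in
theorem prod_dart_eq_prod_isLeft {N : Type*} [CommMonoid N]
    (hG : G.IsBipartiteWith (Set.range Sum.inl) (Set.range Sum.inr)) (F : G.Dart → N) :
    ∏ d, F d = ∏ d : G.Dart with d.fst.isLeft, F d * F d.symm := by
  rw [Finset.prod_mul_distrib, ← Finset.prod_filter_mul_prod_filter_not Finset.univ
    (fun d : G.Dart => d.fst.isLeft = true) F]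
  congr 1
  refine Finset.prod_equiv (Function.Involutive.toPerm _ (Dart.symm_involutive (G := G)))
    (fun d => ?_) (fun d _ => by simp)
  simp only [Finset.mem_filter, Finset.mem_univ, true_and]
  exact (isLeft_snd_iff hG d).symm

open Classical in
theorem prod_ite_matchingDart {N : Type*} [CommMonoid N] (σ : W ≃ B)
    (hσ : ∀ w, G.Adj (Sum.inl w) (Sum.inr (σ w))) (F : G.Dart → N) :
    ∏ d : G.Dart with d.fst.isLeft, (if d = matchingDart σ hσ d.fst then F d else 1) =
      ∏ w, F (matchingDart σ hσ (Sum.inl w)) := by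
  rw [← Finset.prod_filter, Finset.filter_filter]
  symm
  refine Finset.prod_nbij (fun w => matchingDart σ hσ (Sum.inl w)) ?_ ?_ ?_ fun _ _ => rfl
  · intro w _
    exact Finset.mem_filter.mpr ⟨Finset.mem_univ _, rfl, rfl⟩
  · intro w _ w' _ h
    have := congrArg (fun d : G.Dart => d.fst) h
    exact Sum.inl_injective this
  · intro d hd
    simp only [Finset.coe_filter, Finset.mem_univ, true_and, Set.mem_ofPred_eq] at hd
    obtain ⟨hl, hd⟩ := hd
    obtain ⟨w, hw⟩ := Sum.isLeft_iff.mp hl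
    exact ⟨w, by simp, by simp only [← hw, ← hd]⟩

open Classical in
/-- The face permutation on a union of inner faces has the sign prescribed by the Kasteleyn
condition. -/
theorem IsKasteleyn.prod_union_faces {M : OpenFaceGraph G} {φ : G.Dart → ℤˣ}
    (hφ : IsKasteleyn M φ) (hG : G.IsBipartiteWith (Set.range Sum.inl) (Set.range Sum.inr))
    (s : M.Region → Prop) (hs : ¬ s M.outer)
    (hA : ∀ d, s (M.region (M.next d)) ↔ s (M.region d)) :
    ∏ d : G.Dart with s (M.region d), φ (whiteToBlack d) =
      Equiv.Perm.sign (M.next.subtypePerm (p := fun d => s (M.region d)) hA) *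
        (-1) ^ Fintype.card {d : {d // s (M.region d)} // d.1.fst.isLeft} := by
  have := Fintype.ofFinite M.Region
  have hc : ∀ d, (M.next d).fst.isLeft ↔ ¬ d.fst.isLeft := fun d => by
    rw [M.next_apply, M.rot_fst]
    exact isLeft_snd_iff hG d
  have hface : ∀ f, s f → ∏ d : G.Dart with M.region d = f, φ (whiteToBlack d) =
      (-1) ^ ((Finset.univ.filter fun d : G.Dart => M.region d = f ∧ d.fst.isLeft).card + 1) := by
    intro f hf
    refine hφ.inner f (fun h => hs (h ▸ hf)) _ ?_
    have h1 : ∀ d, M.region (M.next d) = f ↔ M.region d = f := fun d => by rw [M.region_next]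
    have h2 := Equiv.Perm.card_eq_two_mul_of_swap_color
      (c := fun d : {d // M.region d = f} => d.1.fst.isLeft) (M.next.subtypePerm h1)
      (fun d => hc d.1)
    rw [← Fintype.card_subtype, h2, ← Fintype.card_subtype]
    congr 1
    exact Fintype.card_congr (Equiv.subtypeSubtypeEquivSubtypeInter (fun d => M.region d = f)
      (fun d : G.Dart => d.fst.isLeft = true))
  have hsign := Equiv.Perm.sign_eq_neg_one_pow_card_add_card_image (M.next.subtypePerm (p := fun d => s (M.region d)) hA)
    (fun d => M.region d.1) (fun d => M.region_next d.1)
    (fun d d' h => Equiv.Perm.sameCycle_subtypePerm.mpr (M.region_eq_iff.mp h))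
  have himage : (Finset.univ.image fun d : {d // s (M.region d)} => M.region d.1) =
      Finset.univ.filter s := by
    ext f
    simp only [Finset.mem_image, Finset.mem_univ, true_and, Finset.mem_filter, Subtype.exists]
    constructor
    · rintro ⟨d, hd, rfl⟩
      exact hd
    · intro hf
      obtain ⟨d, rfl⟩ := M.region_surjective f
      exact ⟨d, hf, rfl⟩
  have hcard := Equiv.Perm.card_eq_two_mul_of_swap_color
      (c := fun d : {d // s (M.region d)} => d.1.fst.isLeft) (M.next.subtypePerm (p := fun d => s (M.region d)) hA)
      (fun d => hc d.1)
  rw [hsign, himage, hcard, pow_add _ (2 * _), pow_mul, neg_one_sq, one_pow, one_mul]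
  have hfib : ∏ d : G.Dart with s (M.region d), φ (whiteToBlack d) =
      ∏ f : M.Region with s f, ∏ d : G.Dart with M.region d = f, φ (whiteToBlack d) := by
    rw [← Finset.prod_fiberwise_of_maps_to (g := M.region) (t := Finset.univ.filter s)
      (fun d hd => by simpa using hd)]
    refine Finset.prod_congr rfl fun f hf => ?_
    rw [Finset.filter_filter]
    refine Finset.prod_congr (Finset.filter_congr fun d _ => ?_) fun _ _ => rfl
    have := (Finset.mem_filter.mp hf).2
    exact ⟨fun h => h.2, fun h => ⟨h ▸ this, h⟩⟩
  -- Each face contributes its number of white-to-black edges plus one; the ones add up to the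
  -- number of faces, that is, of cycles of `next`.
  rw [hfib, Finset.prod_congr rfl fun f hf => hface f (Finset.mem_filter.mp hf).2,
    Finset.prod_pow_eq_pow_sum, Finset.sum_add_distrib, pow_add, mul_comm]
  congr 2
  · simp
  · rw [Fintype.card_congr (Equiv.subtypeSubtypeEquivSubtypeInter (fun d => s (M.region d))
      (fun d : G.Dart => d.fst.isLeft = true)), Fintype.card_subtype,
      Finset.card_eq_sum_card_fiberwise (f := M.region) (t := Finset.univ.filter s)
      (fun d hd => by
        have := (Finset.mem_filter.mp hd).2.1
        simpa using this)]
    refine Finset.sum_congr rfl fun f hf => ?_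
    rw [Finset.filter_filter]
    congr 1
    refine Finset.filter_congr fun d _ => ?_
    have := (Finset.mem_filter.mp hf).2
    exact ⟨fun h => ⟨⟨h.1 ▸ this, h.2⟩, h.1⟩, fun h => ⟨h.2, h.1.2⟩⟩

/-- Kasteleyn's theorem: the sign of the permutation relating two perfect matchings is the
product of the orientations along both of them. -/
theorem IsKasteleyn.prod_mul_prod_eq_sign [DecidableEq W] {M : OpenFaceGraph G} {φ : G.Dart → ℤˣ}
    (hφ : IsKasteleyn M φ) (hG : G.IsBipartiteWith (Set.range Sum.inl) (Set.range Sum.inr))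
    (σ τ : W ≃ B) (hσ : ∀ w, G.Adj (Sum.inl w) (Sum.inr (σ w)))
    (hτ : ∀ w, G.Adj (Sum.inl w) (Sum.inr (τ w))) :
    (∏ w, φ ⟨(Sum.inl w, Sum.inr (σ w)), hσ w⟩) * (∏ w, φ ⟨(Sum.inl w, Sum.inr (τ w)), hτ w⟩) =
      Equiv.Perm.sign (σ.trans τ.symm) := by
  classical
  obtain ⟨s, hs, h⟩ := M.exists_isBoundedBy (isDartMatching_matchingDart σ hσ)
    (isDartMatching_matchingDart τ hτ) M.outer
  have h1 := hφ.prod_union_faces hG s hs h.next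
  have h2 := h.sign_next (c := fun v => v.isLeft = true) (isLeft_snd_iff hG)
  have h3 := sign_alternate_matchingDart hG σ τ hσ hτ
  have h4 : ∏ d : G.Dart with s (M.region d), φ (whiteToBlack d) =
      Equiv.Perm.sign (σ.trans τ.symm) := by
    rw [h1, ← h3]
    convert h2
  rw [← h4, Finset.prod_filter, prod_dart_eq_prod_isLeft hG]
  refine Eq.trans (congrArg₂ (· * ·) (prod_ite_matchingDart σ hσ φ).symm
    (prod_ite_matchingDart τ hτ φ).symm) ?_
  rw [← Finset.prod_mul_distrib]
  refine Finset.prod_congr rfl fun d hd => ?_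
  have hd := (Finset.mem_filter.mp hd).2
  rw [whiteToBlack_of_isLeft hd, whiteToBlack_symm hG hd]
  -- The two sides of an edge agree when it lies in both matchings or in neither; then `φ d` occurs
  -- an even number of times on either side of the equation.
  have hiff : (s (M.region d.symm) ↔ s (M.region d)) ↔
      (d = matchingDart σ hσ d.fst ↔ d = matchingDart τ hτ d.fst) := by
    refine (h.symm d).trans ?_
    generalize matchingDart σ hσ d.fst = p
    generalize matchingDart τ hτ d.fst = q
    by_cases hp : d = p
    · subst hp; tauto
    · by_cases hq : d = q
      · subst hq; tauto
      · tauto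
  have hsq : φ d * φ d = 1 := Int.units_mul_self _
  split_ifs <;> first | (exfalso; tauto) | simp [hsq]

end Bipartite

/-! ### Expansion of the partition function and the determinant over matchings -/

section Expansion

variable {W B : Type*} {G : SimpleGraph (W ⊕ B)}

theorem exists_edge_eq (hG : G.IsBipartiteWith (Set.range Sum.inl) (Set.range Sum.inr))
    (d : G.Dart) : ∃ w b, d.edge = s(Sum.inl w, Sum.inr b) := by
  rcases hG.mem_of_adj d.adj with ⟨⟨w, h1⟩, ⟨b, h2⟩⟩ | ⟨⟨b, h1⟩, ⟨w, h2⟩⟩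
  · exact ⟨w, b, by rw [h1, h2]; rfl⟩
  · exact ⟨w, b, by rw [h1, h2, Sym2.eq_swap]; rfl⟩

/-- The edge of the matching `σ` at the white vertex `w`, with one of its two orientations. -/
def orientedEdge (σ : W ≃ B) (hσ : ∀ w, G.Adj (Sum.inl w) (Sum.inr (σ w))) (o : W → Bool)
    (w : W) : G.Dart :=
  bif o w then ⟨(Sum.inl w, Sum.inr (σ w)), hσ w⟩ else ⟨(Sum.inr (σ w), Sum.inl w), (hσ w).symm⟩

variable {σ : W ≃ B} (hσ : ∀ w, G.Adj (Sum.inl w) (Sum.inr (σ w))) (o : W → Bool)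

theorem edge_orientedEdge (w : W) :
    (orientedEdge σ hσ o w).edge = s(Sum.inl w, Sum.inr (σ w)) := by
  unfold orientedEdge
  cases o w
  · exact Sym2.eq_swap
  · rfl

theorem isLeft_fst_orientedEdge (w : W) : (orientedEdge σ hσ o w).fst.isLeft = o w := by
  unfold orientedEdge
  cases o w <;> rfl

theorem sym2_inl_inr_eq_iff {w w' : W} {b b' : B} :
    s((Sum.inl w : W ⊕ B), Sum.inr b) = s(Sum.inl w', Sum.inr b') ↔ w = w' ∧ b = b' := by
  simp

theorem orientedEdge_injective : Function.Injective (orientedEdge σ hσ o) := by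
  intro w w' h
  have := congrArg Dart.edge h
  rw [edge_orientedEdge, edge_orientedEdge, sym2_inl_inr_eq_iff] at this
  exact this.1

theorem eq_orientedEdge (d : G.Dart) (w : W) (h : d.edge = s(Sum.inl w, Sum.inr (σ w)))
    (ho : o w = d.fst.isLeft) : d = orientedEdge σ hσ o w := by
  rcases (dart_edge_eq_iff d (⟨(Sum.inl w, Sum.inr (σ w)), hσ w⟩ : G.Dart)).mp h with rfl | rfl
  · unfold orientedEdge; rw [ho]; rfl
  · unfold orientedEdge; rw [ho]; rfl

open Classical in
theorem isOrientedDimerConfig_image [Fintype W] :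
    IsOrientedDimerConfig (Finset.univ.image (orientedEdge σ hσ o)) := by
  refine ⟨?_, ?_, ?_⟩
  · intro d hd d' hd' h
    rw [Finset.mem_coe, Finset.mem_image] at hd hd'
    obtain ⟨w, -, rfl⟩ := hd
    obtain ⟨w', -, rfl⟩ := hd'
    rw [edge_orientedEdge, edge_orientedEdge, sym2_inl_inr_eq_iff] at h
    rw [h.1]
  · rintro _ ⟨d, -, rfl⟩
    exact d.edge_mem
  · have key : ∀ w v, v ∈ s((Sum.inl w : W ⊕ B), Sum.inr (σ w)) →
        (∀ w', v ∈ s((Sum.inl w' : W ⊕ B), Sum.inr (σ w')) → w' = w) →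
        ∃! e, e ∈ Dart.edge '' ((Finset.univ.image (orientedEdge σ hσ o) : Finset G.Dart) :
          Set G.Dart) ∧ v ∈ e := by
      intro w v hv huniq
      refine ⟨s(Sum.inl w, Sum.inr (σ w)), ⟨⟨orientedEdge σ hσ o w, ?_,
        edge_orientedEdge hσ o w⟩, hv⟩, ?_⟩
      · simp
      · rintro _ ⟨⟨d, hd, rfl⟩, hv'⟩
        rw [Finset.mem_coe, Finset.mem_image] at hd
        obtain ⟨w', -, rfl⟩ := hd
        rw [edge_orientedEdge] at hv' ⊢
        rw [huniq w' hv']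
    rintro (w | b)
    · exact key w _ (by simp) (by simp +contextual)
    · exact key (σ.symm b) _ (by simp) (by simp +contextual)

open Classical in
theorem exists_eq_image_orientedEdge [Fintype W]
    (hG : G.IsBipartiteWith (Set.range Sum.inl) (Set.range Sum.inr))
    {D : Finset G.Dart} (hD : IsOrientedDimerConfig D) :
    ∃ (σ : W ≃ B) (hσ : ∀ w, G.Adj (Sum.inl w) (Sum.inr (σ w))) (o : W → Bool),
      D = Finset.univ.image (orientedEdge σ hσ o) := by
  obtain ⟨hinj, -, hex⟩ := hD
  have huniq : ∀ v, ∀ d ∈ D, ∀ d' ∈ D, v ∈ d.edge → v ∈ d'.edge → d = d' := by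
    intro v d hd d' hd' h h'
    exact hinj hd hd' ((hex v).unique ⟨⟨d, hd, rfl⟩, h⟩ ⟨⟨d', hd', rfl⟩, h'⟩)
  have hW : ∀ w : W, ∃ b : B, ∃ d ∈ D, d.edge = s(Sum.inl w, Sum.inr b) := by
    intro w
    obtain ⟨_, ⟨⟨d, hd, rfl⟩, hw⟩, -⟩ := hex (Sum.inl w)
    obtain ⟨w', b, h⟩ := exists_edge_eq hG d
    rw [h] at hw
    have : w = w' := by simpa using hw
    exact ⟨b, d, hd, by rw [h, this]⟩
  choose f d hdD hd using hW
  have hf : Function.Bijective f := by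
    constructor
    · intro w w' hww
      have := huniq (Sum.inr (f w)) (d w) (hdD w) (d w') (hdD w') (by simp [hd]) (by simp [hd, hww])
      have := congrArg Dart.edge this
      rw [hd, hd, sym2_inl_inr_eq_iff] at this
      exact this.1
    · intro b
      obtain ⟨_, ⟨⟨d', hd', rfl⟩, hb⟩, -⟩ := hex (Sum.inr b)
      obtain ⟨w, b', h⟩ := exists_edge_eq hG d'
      rw [h] at hb
      have hb : b = b' := by simpa using hb
      subst hb
      have := huniq (Sum.inl w) (d w) (hdD w) d' hd' (by simp [hd]) (by simp [h])
      have := congrArg Dart.edge this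
      rw [hd, h, sym2_inl_inr_eq_iff] at this
      exact ⟨w, this.2⟩
  have hσ : ∀ w, G.Adj (Sum.inl w) (Sum.inr (Equiv.ofBijective f hf w)) := by
    intro w
    have := (d w).edge_mem
    rw [hd] at this
    exact this
  have heq : ∀ w, d w = orientedEdge _ hσ (fun w => (d w).fst.isLeft) w := fun w =>
    eq_orientedEdge hσ _ _ _ (hd w) rfl
  refine ⟨Equiv.ofBijective f hf, hσ, fun w => (d w).fst.isLeft, ?_⟩
  ext d'
  simp only [Finset.mem_image, Finset.mem_univ, true_and, ← heq]
  constructor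
  · intro hd'
    obtain ⟨w, b, h⟩ := exists_edge_eq hG d'
    exact ⟨w, huniq (Sum.inl w) _ (hdD w) d' hd' (by simp [hd]) (by simp [h])⟩
  · rintro ⟨w, rfl⟩
    exact hdD w

variable [Fintype W] [Fintype B]

open Classical in
/-- The partition function as a sum over perfect matchings. -/
theorem orientedDimerZ_eq_sum (hG : G.IsBipartiteWith (Set.range Sum.inl) (Set.range Sum.inr))
    (M : OpenFaceGraph G) {R : Type*} [CommRing R] (a : M.Face → R) {φ : G.Dart → ℤˣ}
    (hφ : ∀ d, φ d.symm = -φ d) :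
    orientedDimerZ M a φ =
      ∑ σ : {σ : W ≃ B // ∀ w, G.Adj (Sum.inl w) (Sum.inr (σ w))},
        ((∏ w, φ ⟨(Sum.inl w, Sum.inr (σ.1 w)), σ.2 w⟩ : ℤˣ) : ℤ) *
          ∏ w, faceKasteleynMatrix M a w (σ.1 w) := by
  have hterm : ∀ σ : {σ : W ≃ B // ∀ w, G.Adj (Sum.inl w) (Sum.inr (σ w))},
      (((∏ w, φ ⟨(Sum.inl w, Sum.inr (σ.1 w)), σ.2 w⟩ : ℤˣ) : ℤ) : R) *
          ∏ w, faceKasteleynMatrix M a w (σ.1 w) =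
        ∑ o : W → Bool, ∏ d ∈ Finset.univ.image (orientedEdge σ.1 σ.2 o),
          ((φ d : ℤ) : R) * a (M.rightFace d) := by
    rintro ⟨σ, hσ⟩
    simp only [Finset.prod_image (orientedEdge_injective hσ _).injOn]
    -- Choosing an orientation for each edge independently is expanding a product of two-term sums;
    -- by skew-symmetry each sum is `φ` times an entry of `K`.
    have hsum := (Fintype.prod_sum (fun (w : W) (t : Bool) =>
      ((φ (orientedEdge σ hσ (fun _ => t) w) : ℤ) : R) *
        a (M.rightFace (orientedEdge σ hσ (fun _ => t) w)))).symm
    refine Eq.trans ?_ hsum.symm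
    rw [Units.coe_prod, Int.cast_prod, ← Finset.prod_mul_distrib]
    refine Finset.prod_congr rfl fun w _ => ?_
    have hs : φ ⟨(Sum.inr (σ w), Sum.inl w), (hσ w).symm⟩ =
        -φ ⟨(Sum.inl w, Sum.inr (σ w)), hσ w⟩ := hφ ⟨(Sum.inl w, Sum.inr (σ w)), hσ w⟩
    rw [Fintype.sum_bool]
    simp only [faceKasteleynMatrix, orientedEdge, cond_true, cond_false, hs, dif_pos (hσ w)]
    push_cast
    ring
  rw [orientedDimerZ, Finset.sum_congr rfl fun σ _ => hterm σ, ← Finset.sum_product']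
  symm
  refine Finset.sum_bij (fun p _ => Finset.univ.image (orientedEdge p.1.1 p.1.2 p.2)) ?_ ?_ ?_ ?_
  · intro p _
    exact Finset.mem_filter.mpr ⟨Finset.mem_univ _, isOrientedDimerConfig_image _ _⟩
  · rintro ⟨⟨σ, hσ⟩, o⟩ - ⟨⟨τ, hτ⟩, o'⟩ - h
    have h1 : ∀ w, orientedEdge σ hσ o w = orientedEdge τ hτ o' w := by
      intro w
      have : orientedEdge σ hσ o w ∈ Finset.univ.image (orientedEdge τ hτ o') :=
        h ▸ Finset.mem_image_of_mem _ (Finset.mem_univ w)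
      obtain ⟨w', -, hw⟩ := Finset.mem_image.mp this
      have h2 := congrArg Dart.edge hw
      rw [edge_orientedEdge, edge_orientedEdge, sym2_inl_inr_eq_iff] at h2
      rw [← hw, h2.1]
    have h2 : σ = τ := by
      ext w
      have h2 := congrArg Dart.edge (h1 w)
      rw [edge_orientedEdge, edge_orientedEdge, sym2_inl_inr_eq_iff] at h2
      exact h2.2
    have h3 : o = o' := by
      ext w
      rw [← isLeft_fst_orientedEdge hσ o, h1, isLeft_fst_orientedEdge]
    subst h2 h3
    rfl
  · intro D hD
    obtain ⟨σ, hσ, o, rfl⟩ := exists_eq_image_orientedEdge hG (Finset.mem_filter.mp hD).2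
    exact ⟨(⟨σ, hσ⟩, o), Finset.mem_univ _, rfl⟩
  · intro p _
    rfl

open Classical in
theorem det_faceKasteleynMatrix_eq_sum {n : ℕ} (rows : Fin n ≃ W) (cols : Fin n ≃ B)
    (M : OpenFaceGraph G) {R : Type*} [CommRing R] (a : M.Face → R) :
    ((faceKasteleynMatrix M a).submatrix rows cols).det =
      ∑ σ : {σ : W ≃ B // ∀ w, G.Adj (Sum.inl w) (Sum.inr (σ w))},
        ((Equiv.Perm.sign (rows.trans (σ.1.trans cols.symm)) : ℤˣ) : ℤ) *
          ∏ w, faceKasteleynMatrix M a w (σ.1 w) := by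
  have h1 : ∀ σ : W ≃ B, ¬ (∀ w, G.Adj (Sum.inl w) (Sum.inr (σ w))) →
      ∏ w, faceKasteleynMatrix M a w (σ w) = 0 := by
    intro σ h
    obtain ⟨w, hw⟩ := not_forall.mp h
    exact Finset.prod_eq_zero (Finset.mem_univ w) (dif_neg hw)
  have h2 : ∀ F : (W ≃ B) → R, (∀ σ, ¬ (∀ w, G.Adj (Sum.inl w) (Sum.inr (σ w))) → F σ = 0) →
      ∑ σ : {σ : W ≃ B // ∀ w, G.Adj (Sum.inl w) (Sum.inr (σ w))}, F σ.1 = ∑ σ, F σ := by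
    intro F hF
    rw [← Finset.sum_subtype (Finset.univ.filter fun σ : W ≃ B =>
      ∀ w, G.Adj (Sum.inl w) (Sum.inr (σ w))) (by simp) F]
    refine Finset.sum_subset (Finset.filter_subset _ _) fun σ _ hσ => hF σ fun h => ?_
    exact hσ (Finset.mem_filter.mpr ⟨Finset.mem_univ _, h⟩)
  rw [h2 (fun σ => ((Equiv.Perm.sign (rows.trans (σ.trans cols.symm)) : ℤˣ) : ℤ) *
    ∏ w, faceKasteleynMatrix M a w (σ w)) fun σ h => by rw [h1 σ h, mul_zero],
    Matrix.det_apply']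
  -- The Leibniz formula pairs row `p i` with column `i`, so the matching from rows to columns is
  -- given by the inverse of `p`.
  refine Fintype.sum_equiv ((Equiv.inv _).trans (Equiv.equivCongr rows cols)) _ _ fun p => ?_
  congr 1
  · congr 2
    rw [← Equiv.Perm.sign_inv]
    congr 1
    ext i
    simp [Equiv.equivCongr]
  · refine Fintype.prod_equiv (p.trans rows) _ _ fun i => ?_
    simp [Equiv.equivCongr]

end Expansion

/-! ### Comparison of the two expansions -/

theorem proposition3p2 {W B : Type*} [Fintype W] [Fintype B]
    (G : SimpleGraph (W ⊕ B))
    (hG : G.IsBipartiteWith (Set.range Sum.inl) (Set.range Sum.inr))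
    (M : OpenFaceGraph G)
    {n : ℕ} (rows : Fin n ≃ W) (cols : Fin n ≃ B)
    (φ : G.Dart → ℤˣ) (hφ : IsKasteleyn M φ) :
    ∃ ε : ℤ, (ε = 1 ∨ ε = -1) ∧
      ∀ (R : Type*) [CommRing R] (a : M.Face → R),
        orientedDimerZ M a φ = (ε : R) * ((faceKasteleynMatrix M a).submatrix rows cols).det := by
  classical
  let s : {σ : W ≃ B // ∀ w, G.Adj (Sum.inl w) (Sum.inr (σ w))} → ℤˣ := fun σ =>
    Equiv.Perm.sign (rows.trans (σ.1.trans cols.symm))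
  let t : {σ : W ≃ B // ∀ w, G.Adj (Sum.inl w) (Sum.inr (σ w))} → ℤˣ := fun σ =>
    ∏ w, φ ⟨(Sum.inl w, Sum.inr (σ.1 w)), σ.2 w⟩
  have key : ∀ σ τ, t σ * t τ = s σ * s τ := by
    intro σ τ
    refine (hφ.prod_mul_prod_eq_sign hG σ.1 τ.1 σ.2 τ.2).trans ?_
    change _ = Equiv.Perm.sign _ * Equiv.Perm.sign _
    -- After one permutation is inverted, `cols` cancels from the product, and the remaining
    -- conjugation by `rows` does not affect the sign.
    rw [← Equiv.Perm.sign_symm (rows.trans (τ.1.trans cols.symm)), mul_comm,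
      ← Equiv.Perm.sign_mul]
    refine Equiv.Perm.sign_eq_sign_of_equiv _ _ rows.symm fun w => ?_
    simp
  obtain ⟨ε, hε⟩ : ∃ ε : ℤˣ, ∀ σ, t σ = ε * s σ := by
    by_cases h : Nonempty {σ : W ≃ B // ∀ w, G.Adj (Sum.inl w) (Sum.inr (σ w))}
    · obtain ⟨τ⟩ := h
      -- The ratio of the two signs is read off at a reference matching. Without perfect matchings
      -- both sums are empty and any sign will do.
      refine ⟨t τ * s τ, fun σ => ?_⟩
      rw [mul_assoc, mul_comm (s τ), ← key, mul_comm (t σ), ← mul_assoc, Int.units_mul_self,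
        one_mul]
    · exact ⟨1, fun σ => absurd ⟨σ⟩ h⟩
  refine ⟨ε, ?_, fun R _ a => ?_⟩
  · rcases Int.units_eq_one_or ε with rfl | rfl <;> simp
  · rw [orientedDimerZ_eq_sum hG M a hφ.skew, det_faceKasteleynMatrix_eq_sum, Finset.mul_sum]
    refine Finset.sum_congr rfl fun σ _ => ?_
    have h1 : ((t σ : ℤ) : R) = ((ε : ℤ) : R) * ((s σ : ℤ) : R) := by
      rw [hε, Units.val_mul, Int.cast_mul]
    rw [← mul_assoc, ← h1]
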